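/- Let $A$ be a finite set of $m$ alternatives and $\mathcal N$ a finite set of $n$ voters. A preference relation is a complete, antisymmetric and transitive binary relation on $A$. A preference profile $R$ assigns a preference relation $\succcurlyeq_i$ to each voter $i$ of some non-empty electorate $N\subseteq\mathcal N$, and a voting rule $f$ assigns an alternative $f(R)\in A$ to every preference profile $R$ (over all non-empty electorates $N \subseteq \mathcal N$). Let $g_R(x,y)=|\{i\in N: x\succcurlyeq_i y\}|-|\{i\in N: y\succcurlyeq_i x\}|$ be the majority margin of $R$. An alternative $x$ is a maximin winner of $R$ if it maximizes $\min_{y\in A\setminus\{x\}} g_R(x,y)$ over $x \in A$, and $f$ is a maximin extension if $f(R)$ is a maximin winner of $R$ for every profile $R$. The rule $f$ satisfies participation if $f(R)\succcurlyeq_i f(R-i)$ for every profile $R$ with electorate $N$, $|N|\ge 2$, and every $i\in N$, where $R-i$ is the profile obtained from $R$ by deleting voter $i$. If $m\ge 4$ and $n\ge 7$, then no maximin extension satisfies participation. If $m=4$ and $n\le 6$, then there is a maximin extension that satisfies participation. -/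

import Mathlib

/-- A (strict) preference relation on `A`: a complete, antisymmetric and transitive relation.
`P.rel x y` reads "`x` is weakly preferred to `y`"; completeness makes it reflexive, and by
antisymmetry there are no ties between distinct alternatives. -/
structure PrefRel (A : Type*) where
  rel : A → A → Prop
  isLinearOrder : IsLinearOrder A rel

/-- A preference profile: an electorate, that is a non-empty finite set of voters, together with
a preference relation for each of its members. -/
structure Profile (V A : Type*) where
  electorate : Finset V
  nonempty : electorate.Nonempty
  pref : electorate → PrefRel A

/-- A voting rule assigns one alternative to every profile (over all non-empty electorates). -/
abbrev VotingRule (V A : Type*) := Profile V A → A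

namespace Profile

variable {V A : Type*}

/-- The profile `R - i`, which exists when `i` is not the only voter of `R`. -/
def remove [DecidableEq V] (R : Profile V A) (i : V) (h : (R.electorate.erase i).Nonempty) :
    Profile V A where
  electorate := R.electorate.erase i
  nonempty := h
  pref := fun j => R.pref ⟨j.1, Finset.mem_of_mem_erase j.2⟩

open Classical in
/-- The majority margin `g_R(x, y)`. -/
noncomputable def margin (R : Profile V A) (x y : A) : ℤ :=
  ((Finset.univ.filter fun i : R.electorate => (R.pref i).rel x y).card : ℤ) -
    ((Finset.univ.filter fun i : R.electorate => (R.pref i).rel y x).card : ℤ)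

/-- The minimum of `g_R(x, y)` over all `y ≠ x`. It is an integer as soon as there are two
alternatives, and `⊤` (the minimum of the empty set) if `x` is the only one. -/
noncomputable def minMargin [Fintype A] [DecidableEq A] (R : Profile V A) (x : A) : WithTop ℤ :=
  (Finset.univ.erase x).inf fun y => (R.margin x y : WithTop ℤ)

/-- `x` is a maximin winner of `R` if it maximizes the minimal majority margin. -/
def IsMaximinWinner [Fintype A] [DecidableEq A] (R : Profile V A) (x : A) : Prop :=
  ∀ z : A, R.minMargin z ≤ R.minMargin x

end Profile

namespace VotingRule

variable {V A : Type*}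

/-- A maximin extension always selects a maximin winner. -/
def IsMaximinExtension [Fintype A] [DecidableEq A] (f : VotingRule V A) : Prop :=
  ∀ R : Profile V A, R.IsMaximinWinner (f R)

/-- Participation: no voter is ever worse off by voting than by abstaining, `f(R) ≿_i f(R - i)`,
for every profile `R` and voter `i` of `R` such that `R - i` is a profile. -/
def Participation [DecidableEq V] (f : VotingRule V A) : Prop :=
  ∀ (R : Profile V A) (i : R.electorate) (h : (R.electorate.erase i.1).Nonempty),
    (R.pref i).rel (f R) (f (R.remove i.1 h))

end VotingRule

/-!
Impossibility. Take the six ballots `abcd, abcd, bcda, cdab, cdab, dabc`. Their maximin winners are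
`a` and `c`. If a seventh voter with ballot `dacb` joins, `c` becomes the only maximin winner; that
voter prefers `a` to `c`, so participation forbids electing `a` from the six ballots. If a seventh
voter with ballot `bcad` joins instead, `a` becomes the only maximin winner; that voter prefers `c`
to `a`, so `c` is forbidden as well. Further alternatives go to the bottom of every ballot, where
they never win (`maximinWinner_topProfile`), and further voters stay away.

Existence. Break ties among the maximin winners by the Borda score, that is the row sum of the
margin matrix, and arbitrarily after that. Suppose that a voter with `x ≻ y` changes the outcome
from `x` to `y`. Every minimal margin moves by exactly one when the voter joins, and `x` gains more
Borda score than `y`, so the minimal margin of `x` must fall and that of `y` must rise. With four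
alternatives this pins down the ballot as `z x y w`, where `z` attains the minimum of `x` and `w` is
the only alternative that attains the minimum of `y`. Before the voter joined there were at most
five voters, and the margins of any three alternatives along a cycle add up to at most the number of
voters; the resulting system of linear inequalities has no integer solution
(`margins_inconsistent`).
-/

/-! ### Signs of preferences and margins -/

namespace PrefRel

variable {A : Type*}

open Classical in
/-- The contribution of one voter to the margin of `x` over `y`: `1` if the voter strictly prefers
`x`, `-1` if the voter strictly prefers `y`, and `0` if `x = y`. -/
noncomputable def sign (P : PrefRel A) (x y : A) : ℤ :=
  (if P.rel x y then 1 else 0) - (if P.rel y x then 1 else 0)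

lemma sign_swap (P : PrefRel A) (x y : A) : P.sign y x = -P.sign x y := by
  simp [sign]

lemma sign_of_not_rel (P : PrefRel A) {x y : A} (h : ¬ P.rel y x) : P.sign x y = 1 := by
  have := P.isLinearOrder.total x y
  simp_all [sign]

lemma sign_eq_one_or (P : PrefRel A) {x y : A} (hxy : x ≠ y) :
    P.sign x y = 1 ∨ P.sign x y = -1 := by
  by_cases h : P.rel y x
  · have h' : ¬ P.rel x y := fun h' => hxy (P.isLinearOrder.antisymm _ _ h' h)
    simp [sign, h, h']
  · exact .inl (P.sign_of_not_rel h)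

/-- Transitivity: a voter cannot agree with all three steps of a cycle. -/
lemma sign_cycle_le (P : PrefRel A) (x y z : A) :
    P.sign x y + P.sign y z + P.sign z x ≤ 1 := by
  have t := P.isLinearOrder.trans
  have h1 := t x y z
  have h2 := t y z x
  have h3 := t z x y
  by_cases a : P.rel x y <;> by_cases b : P.rel y z <;> by_cases c : P.rel z x <;>
    simp_all [sign] <;> split_ifs <;> norm_num

/-- The preference relation that ranks the alternatives by increasing `k`. -/
def ofRank (k : A → ℕ) (hk : Function.Injective k) : PrefRel A where
  rel x y := k x ≤ k y
  isLinearOrder :=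
    { refl := fun _ => le_rfl
      trans := fun _ _ _ => le_trans
      antisymm := fun _ _ h h' => hk (le_antisymm h h')
      total := fun _ _ => le_total _ _ }

lemma sign_ofRank (k : A → ℕ) (hk : Function.Injective k) (x y : A) :
    (ofRank k hk).sign x y = (if k x ≤ k y then 1 else 0) - (if k y ≤ k x then 1 else 0) := by
  simp only [sign, ofRank]
  congr

end PrefRel

namespace Profile

variable {V A : Type*}

lemma margin_eq_sum (R : Profile V A) (x y : A) :
    R.margin x y = ∑ i : R.electorate, (R.pref i).sign x y := by
  simp [margin, PrefRel.sign, Finset.sum_sub_distrib]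

lemma margin_swap (R : Profile V A) (x y : A) : R.margin y x = -R.margin x y := by
  simp [margin]

lemma margin_cycle_le (R : Profile V A) (x y z : A) :
    R.margin x y + R.margin y z + R.margin z x ≤ R.electorate.card := by
  simp only [margin_eq_sum, ← Finset.sum_add_distrib]
  exact (Finset.sum_le_sum fun i _ => (R.pref i).sign_cycle_le x y z).trans (by simp)

lemma margin_le (R : Profile V A) (x y : A) : R.margin x y ≤ R.electorate.card := by
  have h : R.margin x y ≤ ∑ i : R.electorate, 1 := by
    rw [margin_eq_sum]
    refine Finset.sum_le_sum fun i _ => ?_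
    rw [PrefRel.sign]
    split_ifs <;> norm_num
  simpa using h

lemma two_dvd_margin_sub (R : Profile V A) {x y : A} (hxy : x ≠ y) :
    2 ∣ R.margin x y - R.electorate.card := by
  have : R.margin x y - R.electorate.card = ∑ i, ((R.pref i).sign x y - 1) := by
    simp [margin_eq_sum]
  rw [this]
  refine Finset.dvd_sum fun i _ => ?_
  rcases (R.pref i).sign_eq_one_or hxy with h | h <;> simp [h]

/-- The profile in which each voter `v` of the electorate `s` has the preference relation `p v`. -/
def ofFun (s : Finset V) (hs : s.Nonempty) (p : V → PrefRel A) : Profile V A :=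
  ⟨s, hs, fun v => p v⟩

lemma ofFun_congr {s s' : Finset V} (h : s = s') (hs : s.Nonempty) (hs' : s'.Nonempty)
    {p p' : V → PrefRel A} (hp : ∀ v ∈ s, p v = p' v) : ofFun s hs p = ofFun s' hs' p' := by
  subst h
  exact congrArg (Profile.mk s hs) (funext fun v => hp v v.2)

lemma margin_ofFun (s : Finset V) (hs : s.Nonempty) (p : V → PrefRel A) (x y : A) :
    (ofFun s hs p).margin x y = ∑ v ∈ s, (p v).sign x y := by
  rw [margin_eq_sum]
  exact Finset.sum_coe_sort s fun v => (p v).sign x y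

lemma margin_eq_margin_remove_add [DecidableEq V] (R : Profile V A) (i : R.electorate)
    (h : (R.electorate.erase i.1).Nonempty) (x y : A) :
    R.margin x y = (R.remove i.1 h).margin x y + (R.pref i).sign x y := by
  classical
  obtain ⟨s, hs, p⟩ := R
  obtain ⟨i, hi⟩ := i
  obtain ⟨q, rfl⟩ : ∃ q : V → PrefRel A, p = fun v : s => q v :=
    ⟨fun v => if hv : v ∈ s then p ⟨v, hv⟩ else p ⟨i, hi⟩, by funext v; simp⟩
  change (ofFun s hs q).margin x y = (ofFun (s.erase i) h q).margin x y + (q i).sign x y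
  rw [margin_ofFun, margin_ofFun, Finset.sum_erase_add _ _ hi]

end Profile

/-! ### Seven voters and at least four alternatives -/

section Impossibility

variable {V A : Type*} {m : ℕ}

/-- The ballot, as a ranking by natural numbers, that orders the first four alternatives by the
positions `σ` and puts all others below them. The numbering of the alternatives is `e`. -/
def topRank (e : A ≃ Fin m) (σ : Fin 4 ↪ Fin 4) (x : A) : ℕ :=
  if h : (e x : ℕ) < 4 then σ ⟨e x, h⟩ else e x

lemma topRank_injective (e : A ≃ Fin m) (σ : Fin 4 ↪ Fin 4) :
    Function.Injective (topRank e σ) := by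
  intro x y h
  apply e.injective
  apply Fin.ext
  unfold topRank at h
  split_ifs at h with hx hy hy
  · simpa using σ.injective (Fin.ext h)
  · have := (σ ⟨e x, hx⟩).isLt
    omega
  · have := (σ ⟨e y, hy⟩).isLt
    omega
  · exact h

/-- The `j`-th of the first four alternatives. -/
def topAlt (e : A ≃ Fin m) (hm : 4 ≤ m) (j : Fin 4) : A := e.symm (Fin.castLE hm j)

lemma topRank_topAlt (e : A ≃ Fin m) (hm : 4 ≤ m) (σ : Fin 4 ↪ Fin 4) (j : Fin 4) :
    topRank e σ (topAlt e hm j) = σ j := by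
  simp [topRank, topAlt]

lemma exists_topAlt_or (e : A ≃ Fin m) (hm : 4 ≤ m) (x : A) :
    (∃ j, x = topAlt e hm j) ∨ ∀ σ, 4 ≤ topRank e σ x := by
  by_cases h : (e x : ℕ) < 4
  · refine .inl ⟨⟨e x, h⟩, ?_⟩
    rw [topAlt, Equiv.eq_symm_apply]
    rfl
  · refine .inr fun σ => ?_
    simp only [topRank, h, dite_false]
    omega

/-- The preference relation with ranking `topRank e σ`. -/
def topPref (e : A ≃ Fin m) (σ : Fin 4 ↪ Fin 4) : PrefRel A :=
  .ofRank (topRank e σ) (topRank_injective e σ)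

/-- Voter `u k` has the preference relation `topPref e (q k)`; the value at voters outside the range
of `u` plays no role. -/
noncomputable def topBallots (e : A ≃ Fin m) {n : ℕ} (u : Fin n ↪ V)
    (q : Fin n → Fin 4 ↪ Fin 4) : V → PrefRel A :=
  Function.extend u (fun k => topPref e (q k)) fun _ => topPref e (.refl _)

lemma topBallots_apply (e : A ≃ Fin m) {n : ℕ} (u : Fin n ↪ V) (q : Fin n → Fin 4 ↪ Fin 4)
    (k : Fin n) : topBallots e u q (u k) = topPref e (q k) :=
  u.injective.extend_apply _ _ _

/-- The profile in which voter `u k` orders the first four alternatives by the positions `q k` and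
puts all others below them. -/
noncomputable def topProfile (e : A ≃ Fin m) {n : ℕ} [NeZero n] (u : Fin n ↪ V)
    (q : Fin n → Fin 4 ↪ Fin 4) : Profile V A :=
  .ofFun (Finset.univ.map u) (by simp) (topBallots e u q)

/-- The margin of `i` over `j` for ballots on four alternatives given by positions. -/
def topMargin {n : ℕ} (q : Fin n → Fin 4 ↪ Fin 4) (i j : Fin 4) : ℤ :=
  ∑ k, ((if q k i ≤ q k j then 1 else 0) - (if q k j ≤ q k i then 1 else 0))

section

variable (e : A ≃ Fin m) (hm : 4 ≤ m) {n : ℕ} [NeZero n] (u : Fin n ↪ V)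
  (q : Fin n → Fin 4 ↪ Fin 4)

lemma margin_topProfile (x y : A) :
    (topProfile e u q).margin x y = ∑ k, (topPref e (q k)).sign x y := by
  rw [topProfile, Profile.margin_ofFun, Finset.sum_map]
  simp [topBallots_apply]

lemma margin_topProfile_topAlt (i j : Fin 4) :
    (topProfile e u q).margin (topAlt e hm i) (topAlt e hm j) = topMargin q i j := by
  simp [margin_topProfile, topMargin, topPref, PrefRel.sign_ofRank, topRank_topAlt]

lemma margin_topProfile_bot {x : A} (hx : ∀ σ, 4 ≤ topRank e σ x) (i : Fin 4) :
    (topProfile e u q).margin (topAlt e hm i) x = n := by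
  rw [margin_topProfile, Finset.sum_congr rfl (g := fun _ => 1)]
  · simp
  · intro k _
    apply PrefRel.sign_of_not_rel
    have := hx (q k)
    have := (q k i).isLt
    simp only [topPref, PrefRel.ofRank, topRank_topAlt]
    omega

/-- If, on four alternatives, `c` has minimal margin at least `s`, and everything outside `S` has a
smaller one, then the maximin winners with further alternatives at the bottom are in `S`. -/
lemma maximinWinner_topProfile [Fintype A] [DecidableEq A] (s : ℤ) (c : Fin 4)
    (S : Finset (Fin 4)) (hs : s ≤ n) (hs' : -n < s) (hc : ∀ j, j ≠ c → s ≤ topMargin q c j)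
    (hS : ∀ i ∉ S, ∃ j, j ≠ i ∧ topMargin q i j < s) {x : A}
    (hx : (topProfile e u q).IsMaximinWinner x) : ∃ i ∈ S, x = topAlt e hm i := by
  have key : ∀ y, y ≠ x → s ≤ (topProfile e u q).margin x y := by
    intro y hy
    have h1 : (s : WithTop ℤ) ≤ (topProfile e u q).minMargin (topAlt e hm c) := by
      refine Finset.le_inf fun z hz => ?_
      rw [WithTop.coe_le_coe]
      rcases exists_topAlt_or e hm z with ⟨j, rfl⟩ | hz'
      · rw [margin_topProfile_topAlt]
        refine hc j ?_
        rintro rfl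
        simp at hz
      · rwa [margin_topProfile_bot e hm u q hz']
    have h2 : (topProfile e u q).minMargin x ≤ ((topProfile e u q).margin x y : WithTop ℤ) :=
      Finset.inf_le (by simpa using hy)
    exact WithTop.coe_le_coe.1 ((h1.trans (hx _)).trans h2)
  rcases exists_topAlt_or e hm x with ⟨i, rfl⟩ | hx'
  · refine ⟨i, ?_, rfl⟩
    by_contra hi
    obtain ⟨j, hj, hlt⟩ := hS i hi
    have := key (topAlt e hm j) fun h => hj (by simpa [topAlt] using h)
    rw [margin_topProfile_topAlt] at this
    omega
  · have := key (topAlt e hm 0) fun h => by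
      have h4 := hx' (.refl _)
      rw [← h, topRank_topAlt] at h4
      simp at h4
    rw [Profile.margin_swap, margin_topProfile_bot e hm u q hx'] at this
    omega

end

lemma topProfile_snoc_remove [DecidableEq V] (e : A ≃ Fin m) {n : ℕ} [NeZero n]
    (u : Fin (n + 1) ↪ V) (q : Fin n → Fin 4 ↪ Fin 4) (w : Fin 4 ↪ Fin 4)
    (h : ((Finset.univ.map u).erase (u (Fin.last n))).Nonempty) :
    (topProfile e u (Fin.snoc q w : Fin (n + 1) → Fin 4 ↪ Fin 4)).remove (u (Fin.last n)) h =
      topProfile e (Fin.castSuccEmb.trans u) q := by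
  have hs : (Finset.univ.map u).erase (u (Fin.last n)) =
      Finset.univ.map (Fin.castSuccEmb.trans u) := by
    ext v
    simp only [Finset.mem_erase, Finset.mem_map, Finset.mem_univ, true_and]
    constructor
    · rintro ⟨hv, k, rfl⟩
      obtain ⟨l, rfl⟩ := Fin.exists_castSucc_eq.2 fun hk => hv (congrArg u hk)
      exact ⟨l, rfl⟩
    · rintro ⟨l, rfl⟩
      exact ⟨fun hl => (Fin.castSucc_lt_last l).ne (u.injective hl), _, rfl⟩
  refine Profile.ofFun_congr (p := topBallots e u (Fin.snoc q w : Fin (n + 1) → Fin 4 ↪ Fin 4))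
    (p' := topBallots e (Fin.castSuccEmb.trans u) q) hs h _ fun v hv => ?_
  rw [hs] at hv
  obtain ⟨l, -, rfl⟩ := Finset.mem_map.1 hv
  rw [topBallots_apply]
  exact (topBallots_apply _ _ _ _).trans (by simp)

lemma topRank_le_of_participation [DecidableEq V] {f : VotingRule V A} (hf : f.Participation)
    (e : A ≃ Fin m) {n : ℕ} [NeZero n] (u : Fin (n + 1) ↪ V) (q : Fin n → Fin 4 ↪ Fin 4)
    (w : Fin 4 ↪ Fin 4) :
    topRank e w (f (topProfile e u (Fin.snoc q w : Fin (n + 1) → Fin 4 ↪ Fin 4))) ≤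
      topRank e w (f (topProfile e (Fin.castSuccEmb.trans u) q)) := by
  have hne : ((Finset.univ.map u).erase (u (Fin.last n))).Nonempty :=
    ⟨u 0, by simp [(NeZero.ne n).symm, Fin.ext_iff]⟩
  have key := hf (topProfile e u (Fin.snoc q w : Fin (n + 1) → Fin 4 ↪ Fin 4))
    ⟨u (Fin.last n), by simp [topProfile, Profile.ofFun]⟩ hne
  rw [topProfile_snoc_remove] at key
  have hp : (topProfile e u (Fin.snoc q w : Fin (n + 1) → Fin 4 ↪ Fin 4)).pref
      ⟨u (Fin.last n), by simp [topProfile, Profile.ofFun]⟩ = topPref e w := by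
    refine (topBallots_apply _ _ _ _).trans ?_
    rw [Fin.snoc_last]
  rwa [hp] at key

/-- The ballots `abcd, abcd, bcda, cdab, cdab, dabc`, each listing the positions of `a, b, c, d`. -/
def sixBallots : Fin 6 → Fin 4 ↪ Fin 4 :=
  ![⟨![0, 1, 2, 3], by decide⟩, ⟨![0, 1, 2, 3], by decide⟩, ⟨![3, 0, 1, 2], by decide⟩,
    ⟨![2, 3, 0, 1], by decide⟩, ⟨![2, 3, 0, 1], by decide⟩, ⟨![1, 2, 3, 0], by decide⟩]

theorem not_maximinExtension_and_participation [Fintype A] [DecidableEq A] [Fintype V]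
    [DecidableEq V] (hA : 4 ≤ Fintype.card A) (hV : 7 ≤ Fintype.card V) {f : VotingRule V A}
    (hf : f.IsMaximinExtension) : ¬ f.Participation := by
  intro hpart
  let e := Fintype.equivFin A
  let u : Fin 7 ↪ V := (Fin.castLEEmb hV).trans (Fintype.equivFin V).symm.toEmbedding
  -- The two seventh ballots are `dacb` and `bcad`.
  let w₁ : Fin 4 ↪ Fin 4 := ⟨![1, 3, 2, 0], by decide⟩
  let w₂ : Fin 4 ↪ Fin 4 := ⟨![2, 0, 1, 3], by decide⟩
  obtain ⟨i, hi, h6⟩ := maximinWinner_topProfile e hA (Fin.castSuccEmb.trans u) sixBallots (-2) 0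
    {0, 2} (by norm_num) (by norm_num) (by decide) (by decide) (hf _)
  obtain ⟨j, hj, h7⟩ := maximinWinner_topProfile e hA u (Fin.snoc sixBallots w₁) (-1) 2
    {2} (by norm_num) (by norm_num) (by decide) (by decide) (hf _)
  obtain ⟨k, hk, h7'⟩ := maximinWinner_topProfile e hA u (Fin.snoc sixBallots w₂) (-1) 0
    {0} (by norm_num) (by norm_num) (by decide) (by decide) (hf _)
  have h₁ := topRank_le_of_participation hpart e u sixBallots w₁
  have h₂ := topRank_le_of_participation hpart e u sixBallots w₂
  rw [h6, h7, topRank_topAlt, topRank_topAlt] at h₁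
  rw [h6, h7', topRank_topAlt, topRank_topAlt] at h₂
  rw [Finset.mem_singleton] at hj hk
  subst hj hk
  rw [Finset.mem_insert, Finset.mem_singleton] at hi
  rcases hi with rfl | rfl
  · exact absurd h₁ (by decide)
  · exact absurd h₂ (by decide)

end Impossibility

/-! ### Four alternatives and at most six voters -/

namespace Profile

variable {V A : Type*} [Fintype A] [DecidableEq A]

/-- The (symmetric) Borda score of `x`, the sum of its majority margins. -/
noncomputable def borda (R : Profile V A) (x : A) : ℤ := ∑ y, R.margin x y

/-- `x` has maximal minimal margin and, among the alternatives that do, maximal Borda score. -/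
def IsBordaMaximinWinner (R : Profile V A) (x : A) : Prop :=
  ∀ z, R.minMargin z < R.minMargin x ∨ R.minMargin z = R.minMargin x ∧ R.borda z ≤ R.borda x

lemma IsBordaMaximinWinner.isMaximinWinner {R : Profile V A} {x : A}
    (h : R.IsBordaMaximinWinner x) : R.IsMaximinWinner x :=
  fun z => (h z).elim le_of_lt fun h => h.1.le

lemma exists_isBordaMaximinWinner [Nonempty A] (R : Profile V A) :
    ∃ x, R.IsBordaMaximinWinner x := by
  obtain ⟨x, hx⟩ := Finite.exists_max fun x => toLex (R.minMargin x, R.borda x)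
  exact ⟨x, fun z => Prod.Lex.toLex_le_toLex.1 (hx z)⟩

lemma minMargin_eq_min (R : Profile V A) {x y z w : A} (hxy : x ≠ y) (hxz : x ≠ z) (hxw : x ≠ w)
    (huniv : (Finset.univ : Finset A) = {x, y, z, w}) :
    R.minMargin x = ((min (R.margin x y) (min (R.margin x z) (R.margin x w)) : ℤ) : WithTop ℤ) := by
  have : Finset.univ.erase x = {y, z, w} := by
    rw [huniv, Finset.erase_insert]
    simp [hxy, hxz, hxw]
  rw [minMargin, this]
  simp [Finset.inf_insert]

lemma borda_eq_add (R : Profile V A) {x y z w : A} (hxy : x ≠ y) (hxz : x ≠ z) (hxw : x ≠ w)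
    (hyz : y ≠ z) (hyw : y ≠ w) (hzw : z ≠ w)
    (huniv : (Finset.univ : Finset A) = {x, y, z, w}) :
    R.borda x = R.margin x y + R.margin x z + R.margin x w := by
  have h0 : R.margin x x = 0 := by simp [margin]
  rw [borda, huniv, Finset.sum_insert (by simp [hxy, hxz, hxw]),
    Finset.sum_insert (by simp [hyz, hyw]), Finset.sum_insert (by simp [hzw]),
    Finset.sum_singleton, h0]
  ring

end Profile

/-- The margins before a voter with ballot `z x y w` joins at most five others and moves the outcome
from `x` to `y`, where `xz` and `yw` are the minimal margins of `x` and `y`. The last four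
hypotheses compare `x` with `y` and `w` before, and `y` with `x` and `z` after the voter joins. Of
the minimal margins `sz` and `sw` of `z` and `w` it is only used that they occur as margins. -/
theorem margins_inconsistent {n xy xz xw yz yw zw sz sw : ℤ} (hn : n ≤ 5)
    (hxy : |xy| ≤ n) (hxz : |xz| ≤ n) (hxw : |xw| ≤ n)
    (hyz : |yz| ≤ n) (hyw : |yw| ≤ n) (hzw : |zw| ≤ n)
    (pxy : 2 ∣ xy - n) (pxz : 2 ∣ xz - n) (pxw : 2 ∣ xw - n)
    (pyz : 2 ∣ yz - n) (pyw : 2 ∣ yw - n) (pzw : 2 ∣ zw - n)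
    (cxyz : |xy + yz - xz| ≤ n) (cxyw : |xy + yw - xw| ≤ n)
    (cxzw : |xz + zw - xw| ≤ n) (cyzw : |yz + zw - yw| ≤ n)
    (hx : xz ≤ xy) (hx' : xz ≤ xw) (hy : yw < -xy) (hy' : yw < yz)
    (hz : sz = -xz ∨ sz = -yz ∨ sz = zw) (hw : sw = -xw ∨ sw = -yw ∨ sw = -zw)
    (kxy : yw < xz ∨ yw = xz ∧ -xy + yz + yw ≤ xy + xz + xw)
    (kxw : sw < xz ∨ sw = xz ∧ -xw - yw - zw ≤ xy + xz + xw)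
    (kyx : xz - 1 < yw + 1 ∨ xz - 1 = yw + 1 ∧ xy + xz + xw + 1 ≤ -xy + yz + yw - 1)
    (kyz : sz < yw ∨ sz = yw ∧ -xz - yz + zw + 3 ≤ -xy + yz + yw - 1) : False := by
  simp only [abs_le] at *
  have hn0 : 0 ≤ n := by omega
  have h0 : xz ≤ 0 := by
    clear kxw hw hz kyz hxy hxz hxw hyz hyw hzw cxyz cxyw cxzw cyzw
    omega
  have h5 : -5 ≤ xz := by omega
  have hle : sz ≤ yw := by omega
  have hlt : sw ≤ xz := by omega
  have hdiff : yw = xz ∨ yw = xz - 2 := by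
    clear kxw hw hz kyz hxy hxz hxw hyz hyw hzw cxyz cxyw cxzw cyzw
    omega
  have hz' : sz = -yz ∨ sz = zw := by
    clear kxw hw kyz hxy hxz hxw hyz hyw hzw cxyz cxyw cxzw cyzw
    omega
  clear hz
  -- Since `xz + yw ≤ -2` and `yw ≤ xz`, the minimal margin `xz` lies in `[-5, 0]`, and for fixed `n`
  -- and `xz` the remaining system is small.
  interval_cases n <;> interval_cases xz <;> omega

theorem min_add_sign {n a b c d₁ d₂ d₃ : ℤ} (ha : 2 ∣ a - n) (hb : 2 ∣ b - n) (hc : 2 ∣ c - n)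
    (h₁ : d₁ = 1 ∨ d₁ = -1) (h₂ : d₂ = 1 ∨ d₂ = -1) (h₃ : d₃ = 1 ∨ d₃ = -1) :
    min (a + d₁) (min (b + d₂) (c + d₃)) = min a (min b c) + 1 ∨
      min (a + d₁) (min (b + d₂) (c + d₃)) = min a (min b c) - 1 := by
  omega

theorem eq_of_min_fall {a b c d₂ d₃ : ℤ} (h₂ : d₂ = 1 ∨ d₂ = -1) (h₃ : d₃ = 1 ∨ d₃ = -1)
    (h : min (a + 1) (min (b + d₂) (c + d₃)) = min a (min b c) - 1) :
    (b = min a (min b c) ∧ d₂ = -1) ∨ (c = min a (min b c) ∧ d₃ = -1) := by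
  omega

theorem eq_of_min_rise {a b c d : ℤ} (hd : d = 1 ∨ d = -1)
    (h : min (a + -1) (min (b + -1) (c + d)) = min a (min b c) + 1) :
    c = min a (min b c) ∧ c < a ∧ c < b ∧ d = 1 := by
  omega

/-- A voter who prefers `x` to `y` and joins at most five others cannot move the outcome from `x` to
`y`. Here `xy`, … are the margins before that voter joins, `dxz`, … the signs of that voter's
preferences, `sx`, … the minimal margins before, and `tx`, … the minimal margins after. -/
theorem no_switch {n xy xz xw yz yw zw dxz dxw dyz dyw dzw sx sy sz sw tx ty tz tw : ℤ} (hn : n ≤ 5)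
    (hxy : |xy| ≤ n) (hxz : |xz| ≤ n) (hxw : |xw| ≤ n)
    (hyz : |yz| ≤ n) (hyw : |yw| ≤ n) (hzw : |zw| ≤ n)
    (pxy : 2 ∣ xy - n) (pxz : 2 ∣ xz - n) (pxw : 2 ∣ xw - n)
    (pyz : 2 ∣ yz - n) (pyw : 2 ∣ yw - n) (pzw : 2 ∣ zw - n)
    (cxyz : |xy + yz - xz| ≤ n) (cxyw : |xy + yw - xw| ≤ n)
    (cxzw : |xz + zw - xw| ≤ n) (cyzw : |yz + zw - yw| ≤ n)
    (ixz : dxz = 1 ∨ dxz = -1) (ixw : dxw = 1 ∨ dxw = -1) (iyz : dyz = 1 ∨ dyz = -1)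
    (iyw : dyw = 1 ∨ dyw = -1) (izw : dzw = 1 ∨ dzw = -1)
    (txyz : 1 + dyz - dxz ≤ 1) (txyw : 1 + dyw - dxw ≤ 1)
    (txzw : |dxz + dzw - dxw| ≤ 1)
    (hsx : sx = min xy (min xz xw)) (hsy : sy = min (-xy) (min yz yw))
    (hsz : sz = min (-xz) (min (-yz) zw)) (hsw : sw = min (-xw) (min (-yw) (-zw)))
    (htx : tx = min (xy + 1) (min (xz + dxz) (xw + dxw)))
    (hty : ty = min (-xy + -1) (min (yz + dyz) (yw + dyw)))
    (htz : tz = min (-xz + -dxz) (min (-yz + -dyz) (zw + dzw)))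
    (htw : tw = min (-xw + -dxw) (min (-yw + -dyw) (-zw + -dzw)))
    (kxy : sy < sx ∨ sy = sx ∧ -xy + yz + yw ≤ xy + xz + xw)
    (kxz : sz < sx ∨ sz = sx ∧ -xz + -yz + zw ≤ xy + xz + xw)
    (kxw : sw < sx ∨ sw = sx ∧ -xw + -yw + -zw ≤ xy + xz + xw)
    (kyx : tx < ty ∨ tx = ty ∧
      (xy + 1) + (xz + dxz) + (xw + dxw) ≤ (-xy + -1) + (yz + dyz) + (yw + dyw))
    (kyz : tz < ty ∨ tz = ty ∧
      (-xz + -dxz) + (-yz + -dyz) + (zw + dzw) ≤ (-xy + -1) + (yz + dyz) + (yw + dyw))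
    (kyw : tw < ty ∨ tw = ty ∧
      (-xw + -dxw) + (-yw + -dyw) + (-zw + -dzw) ≤ (-xy + -1) + (yz + dyz) + (yw + dyw)) : False := by
  have ex : tx = sx + 1 ∨ tx = sx - 1 := by
    rw [htx, hsx]
    exact min_add_sign pxy pxz pxw (.inl rfl) ixz ixw
  have ey : ty = sy + 1 ∨ ty = sy - 1 := by
    rw [hty, hsy]
    exact min_add_sign (n := -xy) (by simp) (by omega) (by omega) (.inr rfl) iyz iyw
  -- The Borda score of `x` grows by more than that of `y`. If `x` rose or `y` fell, then `x` and `y`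
  -- would have equal minimal margins before and after, and the Borda comparisons would conflict.
  have hd : dyz + dyw - 1 < 1 + dxz + dxw := by omega
  have hdown : tx = sx - 1 := by
    clear hsx hsy hsz hsw htx hty htz htw
    omega
  have hup : ty = sy + 1 := by
    clear hsx hsy hsz hsw htx hty htz htw
    omega
  have hzmem : sz = -xz ∨ sz = -yz ∨ sz = zw := by
    clear * - hsz
    omega
  have hwmem : sw = -xw ∨ sw = -yw ∨ sw = -zw := by
    clear * - hsw
    omega
  have hsxy : sx ≤ xy := hsx ▸ min_le_left _ _
  have hsxz : sx ≤ xz := hsx ▸ (min_le_right _ _).trans (min_le_left _ _)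
  have hsxw : sx ≤ xw := hsx ▸ (min_le_right _ _).trans (min_le_right _ _)
  rw [abs_le] at txzw
  have hfall := hdown
  have hrise := hup
  rw [htx, hsx] at hfall
  rw [hty, hsy] at hrise
  rcases eq_of_min_fall ixz ixw hfall with ⟨hxz', rfl⟩ | ⟨hxw', rfl⟩
  · obtain rfl : dyz = -1 := by
      clear * - iyz txyz
      omega
    obtain ⟨hyw', hy, hy', rfl⟩ := eq_of_min_rise iyw hrise
    obtain rfl : dxw = 1 := by
      clear * - ixw txyw
      omega
    obtain rfl : dzw = 1 := by
      clear * - izw txzw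
      omega
    rw [← hsx] at hxz'
    rw [← hsy] at hyw'
    have hup' : tz = sz + 1 := by
      clear * - htz hsz
      omega
    clear hfall hrise hsx hsy hsz hsw htx hty htz htw
    subst hxz' hyw'
    exact margins_inconsistent (sz := sz) (sw := sw) hn hxy hxz hxw hyz hyw hzw pxy pxz pxw pyz
      pyw pzw cxyz cxyw cxzw cyzw hsxy hsxw hy hy' hzmem hwmem kxy
      (by clear * - kxw; omega)
      (by clear * - kyx hdown hup; omega) (by clear * - kyz hup' hup; omega)
  · obtain rfl : dyw = -1 := by
      clear * - iyw txyw
      omega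
    rw [min_comm (yz + _), min_comm yz] at hrise
    obtain ⟨hyz', hy, hy', rfl⟩ := eq_of_min_rise iyz hrise
    obtain rfl : dxz = 1 := by
      clear * - ixz txyz
      omega
    obtain rfl : dzw = -1 := by
      clear * - izw txzw
      omega
    rw [← hsx] at hxw'
    rw [min_comm yw, ← hsy] at hyz'
    have hup' : tw = sw + 1 := by
      clear * - htw hsw
      omega
    clear hfall hrise hsx hsy hsz hsw htx hty htz htw
    subst hxw' hyz'
    refine margins_inconsistent (zw := -zw) (sz := sw) (sw := sz) hn hxy hxw hxz hyw hyz
      (by rwa [abs_neg]) pxy pxw pxz pyw pyz (by clear * - pzw; omega) cxyw cxyz ?_ ?_ hsxy hsxz hy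
      hy' hwmem (by clear * - hzmem; omega) (by clear * - kxy; omega) (by clear * - kxz; omega)
      (by clear * - kyx hdown hup; omega) (by clear * - kyw hup' hup; omega)
    · rw [abs_le] at *
      clear * - cxzw
      omega
    · rw [abs_le] at *
      clear * - cyzw
      omega

namespace Profile

variable {V A : Type*} [Fintype A] [DecidableEq A] [DecidableEq V]

lemma IsBordaMaximinWinner.rel (hA : Fintype.card A = 4) (R : Profile V A) (i : R.electorate)
    (h : (R.electorate.erase i.1).Nonempty) (hn : R.electorate.card ≤ 6) {x y : A}
    (hx : (R.remove i.1 h).IsBordaMaximinWinner x) (hy : R.IsBordaMaximinWinner y) :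
    (R.pref i).rel y x := by
  by_contra hyx
  have hxy : x ≠ y := by
    rintro rfl
    exact hyx ((R.pref i).isLinearOrder.refl x)
  obtain ⟨z, w, hzw, hdiff⟩ : ∃ z w, z ≠ w ∧ Finset.univ \ {x, y} = ({z, w} : Finset A) := by
    rw [← Finset.card_eq_two, Finset.card_sdiff_of_subset (Finset.subset_univ _),
      Finset.card_univ, hA, Finset.card_pair hxy]
  have hz : z ∈ Finset.univ \ {x, y} := hdiff ▸ by simp
  have hw : w ∈ Finset.univ \ {x, y} := hdiff ▸ by simp
  simp only [Finset.mem_sdiff, Finset.mem_univ, Finset.mem_insert, Finset.mem_singleton, true_and,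
    not_or] at hz hw
  obtain ⟨hxz, hyz⟩ : x ≠ z ∧ y ≠ z := ⟨Ne.symm hz.1, Ne.symm hz.2⟩
  obtain ⟨hxw, hyw⟩ : x ≠ w ∧ y ≠ w := ⟨Ne.symm hw.1, Ne.symm hw.2⟩
  have hu : (Finset.univ : Finset A) = {x, y, z, w} := by
    rw [← Finset.sdiff_union_of_subset (Finset.subset_univ {x, y}), hdiff]
    ext
    simp
    tauto
  have hu₁ : (Finset.univ : Finset A) = {y, x, z, w} := by rw [hu, Finset.insert_comm]
  have hu₂ : (Finset.univ : Finset A) = {z, x, y, w} := by rw [hu]; ext; simp; tauto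
  have hu₃ : (Finset.univ : Finset A) = {w, x, y, z} := by rw [hu]; ext; simp; tauto
  set Q := R.remove i.1 h
  set P := R.pref i
  have hcard : (Q.electorate.card : ℤ) ≤ 5 := by
    have : Q.electorate.card = R.electorate.card - 1 := Finset.card_erase_of_mem i.2
    omega
  have hstep : ∀ a b, R.margin a b = Q.margin a b + P.sign a b :=
    R.margin_eq_margin_remove_add i h
  have habs : ∀ a b, |Q.margin a b| ≤ Q.electorate.card := fun a b => by
    have h₁ := Q.margin_le a b
    have h₂ := Q.margin_le b a
    rw [Q.margin_swap a b] at h₂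
    exact abs_le.2 ⟨by linarith, h₁⟩
  have hcyc : ∀ a b c, |Q.margin a b + Q.margin b c - Q.margin a c| ≤ Q.electorate.card :=
    fun a b c => by
      have h₁ := Q.margin_cycle_le a b c
      have h₂ := Q.margin_cycle_le c b a
      rw [Q.margin_swap a c] at h₁
      rw [Q.margin_swap b c, Q.margin_swap a b] at h₂
      exact abs_le.2 ⟨by linarith, by linarith⟩
  have hone : P.sign x y = 1 := P.sign_of_not_rel hyx
  have hsign : ∀ a b c, P.sign a b + P.sign b c - P.sign a c ≤ 1 := fun a b c => by
    have h₁ := P.sign_cycle_le a b c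
    rw [P.sign_swap a c] at h₁
    linarith
  have hsign' : ∀ a b c, |P.sign a b + P.sign b c - P.sign a c| ≤ 1 := fun a b c => by
    have h₁ := P.sign_cycle_le c b a
    rw [P.sign_swap b c, P.sign_swap a b] at h₁
    exact abs_le.2 ⟨by linarith, hsign a b c⟩
  have mx := fun T : Profile V A => T.minMargin_eq_min hxy hxz hxw hu
  have my := fun T : Profile V A => T.minMargin_eq_min hxy.symm hyz hyw hu₁
  have mz := fun T : Profile V A => T.minMargin_eq_min hxz.symm hyz.symm hzw hu₂
  have mw := fun T : Profile V A => T.minMargin_eq_min hxw.symm hyw.symm hzw.symm hu₃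
  have bx := fun T : Profile V A => T.borda_eq_add hxy hxz hxw hyz hyw hzw hu
  have by' := fun T : Profile V A => T.borda_eq_add hxy.symm hyz hyw hxz hxw hzw hu₁
  have bz := fun T : Profile V A => T.borda_eq_add hxz.symm hyz.symm hzw hxy hxw hyw hu₂
  have bw := fun T : Profile V A => T.borda_eq_add hxw.symm hyw.symm hzw.symm hxy hxz hyz hu₃
  have kxy := hx y
  have kxz := hx z
  have kxw := hx w
  have kyx := hy x
  have kyz := hy z
  have kyw := hy w
  simp only [mx, my, mz, mw, bx, by', bz, bw, hstep, WithTop.coe_lt_coe, WithTop.coe_inj,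
    Q.margin_swap x y, Q.margin_swap x z, Q.margin_swap x w, Q.margin_swap y z, Q.margin_swap y w,
    Q.margin_swap z w, P.sign_swap x y, P.sign_swap x z, P.sign_swap x w, P.sign_swap y z,
    P.sign_swap y w, P.sign_swap z w, hone] at kxy kxz kxw kyx kyz kyw
  exact no_switch hcard (habs x y) (habs x z) (habs x w) (habs y z) (habs y w) (habs z w)
    (Q.two_dvd_margin_sub hxy) (Q.two_dvd_margin_sub hxz) (Q.two_dvd_margin_sub hxw)
    (Q.two_dvd_margin_sub hyz) (Q.two_dvd_margin_sub hyw) (Q.two_dvd_margin_sub hzw)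
    (hcyc x y z) (hcyc x y w) (hcyc x z w) (hcyc y z w)
    (P.sign_eq_one_or hxz) (P.sign_eq_one_or hxw) (P.sign_eq_one_or hyz) (P.sign_eq_one_or hyw)
    (P.sign_eq_one_or hzw) (hone ▸ hsign x y z) (hone ▸ hsign x y w) (hsign' x z w)
    rfl rfl rfl rfl rfl rfl rfl rfl kxy kxz kxw kyx kyz kyw

end Profile

theorem theorem1 (A V : Type*) [Fintype A] [DecidableEq A] [Fintype V] [DecidableEq V] :
    (4 ≤ Fintype.card A → 7 ≤ Fintype.card V →
      ¬ ∃ f : VotingRule V A, f.IsMaximinExtension ∧ f.Participation) ∧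
    (Fintype.card A = 4 → Fintype.card V ≤ 6 →
      ∃ f : VotingRule V A, f.IsMaximinExtension ∧ f.Participation) := by
  refine ⟨fun hA hV ⟨f, hf, hf'⟩ => not_maximinExtension_and_participation hA hV hf hf',
    fun hA hV => ?_⟩
  have : Nonempty A := Fintype.card_pos_iff.1 (by omega)
  choose f hf using fun R : Profile V A => R.exists_isBordaMaximinWinner
  exact ⟨f, fun R => (hf R).isMaximinWinner, fun R i h =>
    Profile.IsBordaMaximinWinner.rel hA R i h ((Finset.card_le_univ _).trans hV) (hf _) (hf R)⟩
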